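/- For integers $n$ define $s_\gamma(n)=\lfloor (n+1)\gamma\rfloor-\lfloor n\gamma\rfloor$, where $\gamma=(3-\sqrt5)/2$, and let $g_i=s_\gamma(i+1)$ for all $i\in\mathbb{Z}$. Let $F_0=0$, $F_1=1$, $F_n=F_{n-1}+F_{n-2}$ be the Fibonacci numbers. The canonical negaFibonacci representation of an integer $n$ is the unique binary word $e_te_{t-1}\cdots e_1$ without leading zeros such that $e_ie_{i+1}\neq 1$ for $1\le i<t$ and $n=\sum_{1\le i\le t}e_i(-1)^{i+1}F_i$ (the empty word for $n=0$). For $i\in\mathbb{Z}$ let $h_i$ be the least significant digit $e_1$ of the canonical negaFibonacci representation of $i$, with $h_0=0$. Then for all integers $i$: (a) $g_i=g_{-3-i}$ for $i\notin\{-2,-1\}$; (b) $h_i=h_{1-i}$ for $i\notin\{0,1\}$; (c) $g_{i-1}=h_{i+1}$ for $i\notin\{-1,0\}$. -/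

import Mathlib

namespace FibWords

/-- The real number `γ = (3 - √5) / 2`. -/
noncomputable def γ : ℝ := (3 - Real.sqrt 5) / 2

/-- `s_θ(n) = ⌊(n+1)θ⌋ - ⌊nθ⌋`, for every integer `n`. -/
noncomputable def sturmian (θ : ℝ) (n : ℤ) : ℤ := ⌊((n : ℝ) + 1) * θ⌋ - ⌊(n : ℝ) * θ⌋

/-- The bi-infinite word `g`, with `g_i = s_γ(i+1)` for all integers `i`. -/
noncomputable def g (i : ℤ) : ℤ := sturmian γ (i + 1)

/-- The integer `∑_{1 ≤ i ≤ t} e_i (-1)^(i+1) F_i` denoted by the word `e_t e_{t-1} ⋯ e_1`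
(most significant digit first); the head of the word `d :: w` has index `i = w.length + 1`. -/
def negaFibValue : List ℕ → ℤ
  | [] => 0
  | d :: w => (d : ℤ) * ((-1) ^ ((w.length + 1) + 1) * (Nat.fib (w.length + 1) : ℤ)) + negaFibValue w

/-- A binary word with no two adjacent digits `1` (leading zeros are allowed). -/
def IsAdmissible (w : List ℕ) : Prop :=
  (∀ d ∈ w, d = 0 ∨ d = 1) ∧ w.IsChain (fun a b => a * b ≠ 1)

/-- `w` is a canonical negaFibonacci representation of `n`: a binary word with no two adjacent
digits `1`, without leading zeros, that denotes `n`. -/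
def IsNegaFibRep (n : ℤ) (w : List ℕ) : Prop :=
  IsAdmissible w ∧ w.head? ≠ some 0 ∧ negaFibValue w = n

/-- The interval of integers denoted by the admissible words of length `t`
(auxiliary, used only to show that representations exist and are unique). -/
def InRange (t : ℕ) (x : ℤ) : Prop :=
  (Even t → 1 - (Nat.fib (t + 1) : ℤ) ≤ x ∧ x ≤ Nat.fib t) ∧
  (¬ Even t → 1 - (Nat.fib t : ℤ) ≤ x ∧ x ≤ Nat.fib (t + 1))

theorem inRange_succ {t : ℕ} {x : ℤ} (h : InRange t x) : InRange (t + 1) x := by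
  have h1 : (Nat.fib (t + 2) : ℤ) = Nat.fib t + Nat.fib (t + 1) := by
    exact_mod_cast Nat.fib_add_two
  have h2 : (0 : ℤ) ≤ Nat.fib (t + 1) := by positivity
  have h3 : (0 : ℤ) ≤ Nat.fib t := by positivity
  unfold InRange at *
  rw [Nat.even_add_one]
  by_cases ht : Even t
  · simp only [ht, forall_const, not_true, not_false_iff, false_imp_iff, true_and, and_true] at *
    exact ⟨h.1, by rw [h1]; linarith [h.2]⟩
  · simp only [ht, forall_const, not_true, not_false_iff, false_imp_iff, true_and, and_true] at *
    exact ⟨by rw [h1]; linarith [h.1], h.2⟩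

theorem inRange_mono {s t : ℕ} (hst : s ≤ t) {x : ℤ} (h : InRange s x) : InRange t x := by
  induction t, hst using Nat.le_induction with
  | base => exact h
  | succ k _ ih => exact inRange_succ ih

theorem inRange_step (t : ℕ) (x : ℤ) :
    (InRange (t + 2) ((-1) ^ ((t + 1 + 1) + 1) * (Nat.fib (t + 1 + 1) : ℤ) + x) ∧
      ¬ InRange (t + 1) ((-1) ^ ((t + 1 + 1) + 1) * (Nat.fib (t + 1 + 1) : ℤ) + x)) ↔
    InRange t x := by
  have h1 : (Nat.fib (t + 2) : ℤ) = Nat.fib t + Nat.fib (t + 1) := by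
    exact_mod_cast Nat.fib_add_two
  have h4 : (Nat.fib (t + 3) : ℤ) = Nat.fib (t + 1) + Nat.fib (t + 2) := by
    exact_mod_cast Nat.fib_add_two
  have h2 : (0 : ℤ) < Nat.fib (t + 1) := by exact_mod_cast Nat.fib_pos.2 (Nat.succ_pos t)
  have h3 : (0 : ℤ) ≤ Nat.fib t := by positivity
  have e1 : Even (t + 1) ↔ ¬ Even t := Nat.even_add_one
  have e2 : Even (t + 2) ↔ Even t := by rw [Nat.even_add_one, e1, not_not]
  unfold InRange
  rw [e1, e2]
  by_cases ht : Even t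
  · have hp : (-1 : ℤ) ^ ((t + 1 + 1) + 1) = -1 := by
      apply Odd.neg_one_pow
      rw [← Nat.not_even_iff_odd, Nat.even_add_one, not_not]
      exact e2.2 ht
    rw [hp]
    simp only [ht, forall_const, not_true, not_false_iff, false_imp_iff, true_and, and_true]
    rw [show t + 2 + 1 = t + 3 from rfl, show t + 1 + 1 = t + 2 from rfl, h4, h1]
    omega
  · have hp : (-1 : ℤ) ^ ((t + 1 + 1) + 1) = 1 := by
      apply Even.neg_one_pow
      rw [Nat.even_add_one]
      exact fun h => ht (e2.1 h)
    rw [hp]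
    simp only [ht, forall_const, not_true, not_false_iff, false_imp_iff, true_and, and_true]
    rw [show t + 2 + 1 = t + 3 from rfl, show t + 1 + 1 = t + 2 from rfl, h4, h1]
    omega

theorem IsAdmissible.tail {d : ℕ} {w : List ℕ} (h : IsAdmissible (d :: w)) : IsAdmissible w :=
  ⟨fun e he => h.1 e (List.mem_cons_of_mem _ he), h.2.tail⟩

theorem IsAdmissible.zero_cons {w : List ℕ} (h : IsAdmissible w) : IsAdmissible (0 :: w) := by
  refine ⟨?_, ?_⟩
  · intro d hd
    rcases List.mem_cons.1 hd with rfl | hd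
    · exact Or.inl rfl
    · exact h.1 d hd
  · cases w with
    | nil => exact List.IsChain.singleton _
    | cons a w => exact List.IsChain.cons_cons (by simp) h.2

theorem IsAdmissible.one_zero_cons {w : List ℕ} (h : IsAdmissible w) :
    IsAdmissible (1 :: 0 :: w) := by
  refine ⟨?_, List.IsChain.cons_cons (by simp) h.zero_cons.2⟩
  intro d hd
  rcases List.mem_cons.1 hd with rfl | hd
  · exact Or.inr rfl
  · exact h.zero_cons.1 d hd

theorem negaFibValue_zero_cons (w : List ℕ) : negaFibValue (0 :: w) = negaFibValue w := by
  simp [negaFibValue]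

theorem inRange_zero (x : ℤ) : InRange 0 x ↔ x = 0 := by
  simp [InRange]; omega

theorem inRange_one (x : ℤ) : InRange 1 x ↔ x = 0 ∨ x = 1 := by
  simp [InRange]; omega

theorem inRange_value (t : ℕ) : ∀ w : List ℕ, w.length = t → IsAdmissible w →
    InRange t (negaFibValue w) ∧ ∀ u, w = 1 :: u → ¬ InRange u.length (negaFibValue w) := by
  induction t using Nat.strong_induction_on with
  | _ t ih =>
    intro w hw hadm
    match w, hw, hadm with
    | [], hw, _ =>
      subst hw
      simp [negaFibValue, inRange_zero]
    | d :: u, hw, hadm =>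
      rcases hadm.1 d (by simp) with rfl | rfl
      · have h := ih u.length (by simp at hw; omega) u rfl hadm.tail
        rw [negaFibValue_zero_cons]
        subst hw
        exact ⟨inRange_succ h.1, by simp⟩
      · match u, hw, hadm with
        | [], hw, _ =>
          subst hw
          simp [negaFibValue, inRange_zero, inRange_one]
        | e :: v, hw, hadm =>
          have he : e = 0 := by
            rcases hadm.1 e (by simp) with h | h
            · exact h
            · subst h
              exact absurd rfl (List.isChain_cons_cons.1 hadm.2).1
          subst he
          have h := ih v.length (by simp at hw; omega) v rfl hadm.tail.tail
          have hs := (inRange_step v.length (negaFibValue v)).2 h.1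
          have hv : negaFibValue (1 :: 0 :: v) =
              (-1) ^ ((v.length + 1 + 1) + 1) * (Nat.fib (v.length + 1 + 1) : ℤ)
                + negaFibValue v := by
            simp [negaFibValue]
          rw [hv]
          subst hw
          refine ⟨hs.1, ?_⟩
          intro u hu
          obtain rfl : 0 :: v = u := by simpa using hu
          exact hs.2

theorem exists_admissible (t : ℕ) : ∀ n : ℤ, InRange t n →
    ∃ w : List ℕ, w.length = t ∧ IsAdmissible w ∧ negaFibValue w = n := by
  have hnil : IsAdmissible [] := ⟨by simp, List.IsChain.nil⟩
  induction t using Nat.twoStepInduction with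
  | zero =>
    intro n hn
    exact ⟨[], rfl, hnil, ((inRange_zero n).1 hn).symm⟩
  | one =>
    intro n hn
    rcases (inRange_one n).1 hn with rfl | rfl
    · exact ⟨[0], rfl, hnil.zero_cons, by simp [negaFibValue]⟩
    · exact ⟨[1], rfl, ⟨by simp, List.IsChain.singleton _⟩, by simp [negaFibValue]⟩
  | more t ih0 ih1 =>
    intro n hn
    by_cases h : InRange (t + 1) n
    · obtain ⟨w, hl, hw, hv⟩ := ih1 n h
      exact ⟨0 :: w, by simp [hl], hw.zero_cons, by rw [negaFibValue_zero_cons, hv]⟩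
    · have hs := inRange_step t (n - (-1) ^ ((t + 1 + 1) + 1) * (Nat.fib (t + 1 + 1) : ℤ))
      rw [add_sub_cancel] at hs
      obtain ⟨w, hl, hw, hv⟩ := ih0 _ (hs.1 ⟨hn, h⟩)
      refine ⟨1 :: 0 :: w, by simp [hl], hw.one_zero_cons, ?_⟩
      simp [negaFibValue, hl, hv]

theorem exists_canonical (w : List ℕ) (hw : IsAdmissible w) :
    ∃ u, IsNegaFibRep (negaFibValue w) u := by
  induction w with
  | nil => exact ⟨[], hw, by simp, rfl⟩
  | cons d w ih =>
    rcases hw.1 d (by simp) with rfl | rfl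
    · rw [negaFibValue_zero_cons]
      exact ih hw.tail
    · exact ⟨1 :: w, hw, by simp, rfl⟩

theorem eq_of_length_eq (w : List ℕ) : ∀ u : List ℕ, w.length = u.length → IsAdmissible w →
    IsAdmissible u → negaFibValue w = negaFibValue u → w = u := by
  induction w with
  | nil =>
    intro u hl _ _ _
    exact (List.length_eq_zero_iff.1 hl.symm).symm
  | cons d w ih =>
    intro u hl hw hu hv
    cases u with
    | nil => simp at hl
    | cons e u =>
      have hl' : w.length = u.length := by simpa using hl
      have key : ∀ a b : List ℕ, a.length = b.length → IsAdmissible (0 :: a) →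
          IsAdmissible (1 :: b) → negaFibValue (0 :: a) ≠ negaFibValue (1 :: b) := by
        intro a b hab ha hb he
        have h1 := (inRange_value _ a rfl ha.tail).1
        have h2 := (inRange_value _ (1 :: b) rfl hb).2 b rfl
        rw [← he, negaFibValue_zero_cons, ← hab] at h2
        exact h2 h1
      rcases hw.1 d (by simp) with rfl | rfl <;> rcases hu.1 e (by simp) with rfl | rfl
      · rw [negaFibValue_zero_cons, negaFibValue_zero_cons] at hv
        rw [ih u hl' hw.tail hu.tail hv]
      · exact absurd hv (key w u hl' hw hu)
      · exact absurd hv.symm (key u w hl'.symm hu hw)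
      · have hv' : negaFibValue w = negaFibValue u := by
          simpa [negaFibValue, hl'] using hv
        rw [ih u hl' hw.tail hu.tail hv']

theorem IsNegaFibRep.length_le {n : ℤ} {w u : List ℕ} (hw : IsNegaFibRep n w)
    (hu : IsNegaFibRep n u) : u.length ≤ w.length := by
  by_contra! hlt
  obtain ⟨hwa, -, hwv⟩ := hw
  obtain ⟨hua, huh, huv⟩ := hu
  cases u with
  | nil => simp at hlt
  | cons d u =>
    rcases hua.1 d (by simp) with rfl | rfl
    · simp at huh
    · have h1 := (inRange_value _ w rfl hwa).1
      have h2 := (inRange_value _ (1 :: u) rfl hua).2 u rfl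
      rw [huv, ← hwv] at h2
      exact h2 (inRange_mono (by simp at hlt; omega) h1)

theorem exists_inRange (n : ℤ) : ∃ t, InRange t n := by
  have hf : ∀ k : ℕ, (k : ℤ) ≤ Nat.fib (k + 1) := by
    intro k
    induction k using Nat.twoStepInduction with
    | zero => simp
    | one => simp
    | more k ih0 ih1 =>
      have h1 : (Nat.fib (k + 2 + 1) : ℤ) = Nat.fib (k + 1) + Nat.fib (k + 1 + 1) := by
        exact_mod_cast Nat.fib_add_two
      have h2 : (0 : ℤ) < Nat.fib (k + 1) := by exact_mod_cast Nat.fib_pos.2 (Nat.succ_pos k)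
      push_cast at *
      omega
  refine ⟨2 * (n.natAbs + 1), ?_⟩
  have he : Even (2 * (n.natAbs + 1)) := even_two_mul _
  have h1 := hf (2 * (n.natAbs + 1))
  have h2 := hf (2 * n.natAbs + 1)
  have h3 := neg_abs_le n
  have h4 := le_abs_self n
  refine ⟨fun _ => ⟨?_, ?_⟩, fun h => absurd he h⟩
  · push_cast at h1; omega
  · rw [show 2 * n.natAbs + 1 + 1 = 2 * (n.natAbs + 1) by ring] at h2
    push_cast at h2
    omega

/-- Every integer has exactly one canonical negaFibonacci representation. -/
theorem existsUnique_negaFibRep (n : ℤ) : ∃! w, IsNegaFibRep n w := by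
  obtain ⟨t, ht⟩ := exists_inRange n
  obtain ⟨w, -, hw, hv⟩ := exists_admissible t n ht
  obtain ⟨u, hu⟩ := exists_canonical w hw
  rw [hv] at hu
  refine ⟨u, hu, fun v hv' => ?_⟩
  exact eq_of_length_eq v u (le_antisymm (hu.length_le hv') (hv'.length_le hu)) hv'.1 hu.1
    (hv'.2.2.trans hu.2.2.symm)

/-- The canonical negaFibonacci representation of `n`, most significant digit first. -/
noncomputable def negaFibRep (n : ℤ) : List ℕ := (existsUnique_negaFibRep n).choose

/-- The bi-infinite word `h`: `h_i` is the least significant (last) digit of the canonical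
negaFibonacci representation of `i`; the representation of `0` is the empty word, whose digits
are all read as `0`. -/
noncomputable def h (i : ℤ) : ℕ := (negaFibRep i).getLastD 0

end FibWords

/-!
Both words are values of the Sturmian word `s_γ`: by definition `g_i = s_γ(i + 1)`, and
`h_i = s_γ(-i)` for every integer `i`. For the latter, `γ` times the integer written `e_t ⋯ e_1` in
negaFibonacci notation is congruent modulo `1` to minus the number `0.e_1 e_2 ⋯ e_t` in base `φ`,
because `(-1)^(k+1) F_k γ ≡ -φ^(-k)`. That number lies in `[0, 1)`, and in `[1/φ, 1)` exactly when
`e_1 = 1`; since `1/φ = 1 - γ`, this is the coding of `s_γ` as a rotation by `γ`.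
All three claims are then instances of the symmetry `s_θ(-1 - n) = s_θ(n)`, which holds for
irrational `θ` as soon as neither `nθ` nor `(n + 1)θ` vanishes.
-/

namespace FibWords

open scoped goldenRatio

theorem floor_neg_of_irrational {x : ℝ} (hx : Irrational x) : ⌊-x⌋ = -⌊x⌋ - 1 := by
  have hceil : ⌈x⌉ = ⌊x⌋ + 1 := (Int.ceil_eq_floor_add_one_iff_notMem x).2 fun ⟨m, hm⟩ =>
    hx.ne_int m hm.symm
  rw [Int.floor_neg, hceil, neg_add']

theorem sturmian_neg_one_sub {θ : ℝ} (hθ : Irrational θ) {n : ℤ} (h0 : n ≠ 0) (h1 : n ≠ -1) :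
    sturmian θ (-1 - n) = sturmian θ n := by
  have hfloor : ⌊-((n : ℝ) * θ)⌋ = -⌊(n : ℝ) * θ⌋ - 1 :=
    floor_neg_of_irrational (hθ.intCast_mul h0)
  have hfloor_succ : ⌊-(((n : ℝ) + 1) * θ)⌋ = -⌊((n : ℝ) + 1) * θ⌋ - 1 :=
    floor_neg_of_irrational (by exact_mod_cast hθ.intCast_mul (m := n + 1) (by omega))
  calc sturmian θ (-1 - n)
      = ⌊-((n : ℝ) * θ)⌋ - ⌊-(((n : ℝ) + 1) * θ)⌋ := by
        unfold sturmian
        push_cast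
        ring_nf
    _ = sturmian θ n := by
        rw [hfloor, hfloor_succ, sturmian]
        ring

theorem sturmian_eq_ite_fract {θ : ℝ} (h0 : 0 ≤ θ) (h1 : θ ≤ 1) (n : ℤ) :
    sturmian θ n = if 1 - θ ≤ Int.fract ((n : ℝ) * θ) then 1 else 0 := by
  have hfloor : ⌊((n : ℝ) + 1) * θ⌋ = ⌊(n : ℝ) * θ⌋ + ⌊Int.fract ((n : ℝ) * θ) + θ⌋ := by
    rw [← Int.floor_intCast_add, ← add_assoc, Int.floor_add_fract, add_one_mul]
  rw [sturmian, hfloor, add_sub_cancel_left]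
  have hnonneg := Int.fract_nonneg ((n : ℝ) * θ)
  have hlt := Int.fract_lt_one ((n : ℝ) * θ)
  split_ifs with hle <;> rw [Int.floor_eq_iff] <;> push_cast <;> constructor <;> linarith

theorem inv_goldenRatio_pos : 0 < φ⁻¹ := inv_pos.2 Real.goldenRatio_pos

theorem inv_goldenRatio_lt_one : φ⁻¹ < 1 := inv_lt_one_of_one_lt₀ Real.one_lt_goldenRatio

theorem inv_goldenRatio_mul_add_one : φ⁻¹ * (φ⁻¹ + 1) = 1 := by
  rw [Real.inv_goldenRatio]
  linear_combination Real.goldenConj_sq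

theorem γ_eq_one_sub_inv_goldenRatio : γ = 1 - φ⁻¹ := by
  rw [Real.inv_goldenRatio, Real.goldenConj, γ]
  ring

theorem irrational_γ : Irrational γ := by
  rw [γ_eq_one_sub_inv_goldenRatio]
  exact_mod_cast (irrational_inv_iff.2 Real.goldenRatio_irrational).intCast_sub 1

/-- The real number `∑_{1 ≤ i ≤ t} e_i φ^(-i)`, that is `0.e_1 e_2 ⋯ e_t` in base `φ`, attached to
the word `e_t e_{t-1} ⋯ e_1`. As in `negaFibValue`, the list starts with `e_t`. It represents the
class of `-negaFibValue w * γ` modulo `1`. -/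
noncomputable def phinaryFraction : List ℕ → ℝ
  | [] => 0
  | d :: w => (d : ℝ) * φ⁻¹ ^ (w.length + 1) + phinaryFraction w

theorem phinaryFraction_concat (w : List ℕ) (d : ℕ) :
    phinaryFraction (w ++ [d]) = φ⁻¹ * (phinaryFraction w + d) := by
  induction w with
  | nil => simp [phinaryFraction, mul_comm]
  | cons e w ih =>
    simp only [List.cons_append, phinaryFraction, ih, List.length_append, List.length_singleton]
    ring

theorem phinaryFraction_nonneg (w : List ℕ) : 0 ≤ phinaryFraction w := by
  induction w with
  | nil => exact le_rfl
  | cons d w ih =>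
    rw [phinaryFraction]
    positivity

theorem neg_one_pow_mul_fib_succ_mul_γ (k : ℕ) :
    (-1) ^ (k + 2) * (Nat.fib (k + 1) : ℝ) * γ =
      (((-1) ^ k * ((Nat.fib (k + 1) : ℤ) - Nat.fib k) : ℤ) : ℝ) - φ⁻¹ ^ (k + 1) := by
  rw [γ_eq_one_sub_inv_goldenRatio, Real.inv_goldenRatio, neg_pow ψ]
  push_cast
  linear_combination (-1) ^ k * Real.goldenConj_mul_fib_succ_add_fib k

theorem exists_neg_negaFibValue_mul_γ_sub_eq_intCast (w : List ℕ) :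
    ∃ z : ℤ, -(negaFibValue w : ℝ) * γ - phinaryFraction w = z := by
  induction w with
  | nil => exact ⟨0, by simp [negaFibValue, phinaryFraction]⟩
  | cons d w ih =>
    obtain ⟨z, hz⟩ := ih
    refine ⟨z - d * ((-1) ^ w.length * (Nat.fib (w.length + 1) - Nat.fib w.length)), ?_⟩
    have hfib := neg_one_pow_mul_fib_succ_mul_γ w.length
    simp only [negaFibValue, phinaryFraction]
    push_cast at hfib ⊢
    linear_combination hz - (d : ℝ) * hfib

theorem IsAdmissible.of_concat {w : List ℕ} {d : ℕ} (hw : IsAdmissible (w ++ [d])) :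
    IsAdmissible w :=
  ⟨fun e he => hw.1 e (List.mem_append_left _ he), hw.2.left_of_append⟩

theorem IsAdmissible.getLastD_eq_zero_of_concat_one {w : List ℕ} (hw : IsAdmissible (w ++ [1])) :
    w.getLastD 0 = 0 := by
  rcases w.eq_nil_or_concat' with rfl | ⟨u, e, rfl⟩
  · rfl
  · have hne : e * 1 ≠ 1 := (List.isChain_append.1 hw.2).2.2 e (by simp) 1 (by simp)
    have he : e = 0 ∨ e = 1 := hw.1 e (by simp)
    rw [List.getLastD_concat]
    omega

theorem IsAdmissible.phinaryFraction_lt_one_and_lt_inv_goldenRatio {w : List ℕ}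
    (hw : IsAdmissible w) :
    phinaryFraction w < 1 ∧ (w.getLastD 0 = 0 → phinaryFraction w < φ⁻¹) := by
  induction w using List.reverseRecOn with
  | nil => exact ⟨one_pos, fun _ => inv_goldenRatio_pos⟩
  | append_singleton w d ih =>
    obtain ⟨ih_one, ih_inv⟩ := ih hw.of_concat
    rw [phinaryFraction_concat, List.getLastD_concat]
    rcases hw.1 d (by simp) with rfl | rfl
    · have hlt : φ⁻¹ * (phinaryFraction w + (0 : ℕ)) < φ⁻¹ :=
        mul_lt_of_lt_one_right inv_goldenRatio_pos (by simpa using ih_one)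
      exact ⟨hlt.trans inv_goldenRatio_lt_one, fun _ => hlt⟩
    · have hlt : phinaryFraction w < φ⁻¹ := ih_inv hw.getLastD_eq_zero_of_concat_one
      refine ⟨?_, fun h => absurd h one_ne_zero⟩
      calc φ⁻¹ * (phinaryFraction w + (1 : ℕ)) < φ⁻¹ * (φ⁻¹ + 1) := by push_cast; gcongr
        _ = 1 := inv_goldenRatio_mul_add_one

theorem inv_goldenRatio_le_phinaryFraction {w : List ℕ} (hw : w.getLastD 0 = 1) :
    φ⁻¹ ≤ phinaryFraction w := by
  rcases w.eq_nil_or_concat' with rfl | ⟨u, d, rfl⟩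
  · exact absurd hw zero_ne_one
  · rw [List.getLastD_concat] at hw
    subst hw
    rw [phinaryFraction_concat]
    refine le_mul_of_one_le_right inv_goldenRatio_pos.le ?_
    simpa using phinaryFraction_nonneg u

theorem IsAdmissible.getLastD_eq_ite {w : List ℕ} (hw : IsAdmissible w) :
    w.getLastD 0 = if φ⁻¹ ≤ phinaryFraction w then 1 else 0 := by
  have hdigit : w.getLastD 0 = 0 ∨ w.getLastD 0 = 1 := by
    rcases w.eq_nil_or_concat' with rfl | ⟨u, d, rfl⟩
    · exact Or.inl rfl
    · simpa using hw.1 d (by simp)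
  rcases hdigit with h | h
  · rw [h, if_neg (hw.phinaryFraction_lt_one_and_lt_inv_goldenRatio.2 h).not_ge]
  · rw [h, if_pos (inv_goldenRatio_le_phinaryFraction h)]

theorem IsAdmissible.fract_neg_negaFibValue_mul_γ {w : List ℕ} (hw : IsAdmissible w) :
    Int.fract (-(negaFibValue w : ℝ) * γ) = phinaryFraction w :=
  Int.fract_eq_iff.2
    ⟨phinaryFraction_nonneg w, hw.phinaryFraction_lt_one_and_lt_inv_goldenRatio.1,
      exists_neg_negaFibValue_mul_γ_sub_eq_intCast w⟩

theorem IsAdmissible.getLastD_eq_sturmian {w : List ℕ} (hw : IsAdmissible w) :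
    (w.getLastD 0 : ℤ) = sturmian γ (-negaFibValue w) := by
  have hγ : 1 - γ = φ⁻¹ := by rw [γ_eq_one_sub_inv_goldenRatio, sub_sub_cancel]
  have hγ_nonneg : 0 ≤ γ := by linarith [inv_goldenRatio_lt_one]
  have hγ_le : γ ≤ 1 := by linarith [inv_goldenRatio_pos]
  rw [sturmian_eq_ite_fract hγ_nonneg hγ_le, Int.cast_neg, hw.fract_neg_negaFibValue_mul_γ,
    hw.getLastD_eq_ite, hγ, Nat.cast_ite, Nat.cast_one, Nat.cast_zero]

theorem h_eq_sturmian_neg (n : ℤ) : (h n : ℤ) = sturmian γ (-n) := by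
  obtain ⟨hadm, -, hval⟩ : IsNegaFibRep n (negaFibRep n) :=
    (existsUnique_negaFibRep n).choose_spec.1
  rw [h, hadm.getLastD_eq_sturmian, hval]

end FibWords

theorem theorem7 :
    (∀ i : ℤ, i ∉ ({-2, -1} : Set ℤ) → FibWords.g i = FibWords.g (-3 - i)) ∧
    (∀ i : ℤ, i ∉ ({0, 1} : Set ℤ) → FibWords.h i = FibWords.h (1 - i)) ∧
    (∀ i : ℤ, i ∉ ({-1, 0} : Set ℤ) → FibWords.g (i - 1) = (FibWords.h (i + 1) : ℤ)) := by
  have reflect {n : ℤ} (h0 : n ≠ 0) (h1 : n ≠ -1) :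
      FibWords.sturmian FibWords.γ n = FibWords.sturmian FibWords.γ (-1 - n) :=
    (FibWords.sturmian_neg_one_sub FibWords.irrational_γ h0 h1).symm
  simp only [Set.mem_insert_iff, Set.mem_singleton_iff, not_or]
  refine ⟨fun i hi => ?_, fun i hi => ?_, fun i hi => ?_⟩
  · rw [FibWords.g, FibWords.g, reflect (by omega) (by omega)]
    congr 1
    ring
  · zify
    rw [FibWords.h_eq_sturmian_neg, FibWords.h_eq_sturmian_neg, reflect (by omega) (by omega)]
    congr 1
    ring
  · rw [FibWords.g, FibWords.h_eq_sturmian_neg, reflect (by omega) (by omega)]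
    congr 1
    ring
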